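/- For integers $n, m \ge 0$, let $\mathrm{Conf}_n(S^2)$ be the space of unordered $n$-tuples of distinct points of the $2$-sphere (the quotient by $S_n$ of the space of ordered $n$-tuples of distinct points), and let $\mathrm{Conf}_{n,m}(S^2)$ be the space of configurations of $n+m$ distinct points of $S^2$ divided into $n$ ``old'' and $m$ ``new'' points (the quotient by $S_n \times S_m$ of the space of ordered $(n+m)$-tuples of distinct points). Let $P : \mathrm{Conf}_{n,m}(S^2) \to \mathrm{Conf}_n(S^2)$ be the map that forgets the new points. For every $n \ge 3$ and every $m \ge 0$ divisible by $n(n-1)(n-2)$, the map $P$ has a continuous section, that is, there is a continuous map $S : \mathrm{Conf}_n(S^2) \to \mathrm{Conf}_{n,m}(S^2)$ with $P \circ S = \mathrm{id}$. -/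

import Mathlib

/-- `S²`, the unit sphere of Euclidean 3-space. -/
abbrev TwoSphere : Type := Metric.sphere (0 : EuclideanSpace ℝ (Fin 3)) 1

/-- The space of families of pairwise distinct points of `X` indexed by `ι`, with the subspace
topology of the product `ι → X`. For `ι = Fin k` it consists of the ordered `k`-tuples of distinct
points. -/
abbrev PConf (ι X : Type*) : Type _ := {x : ι → X // Function.Injective x}

/-- The orbit relation of a group `G` of permutations of the index set, acting on `PConf ι X` by
relabelling the points. -/
def PConf.orbitSetoid {ι : Type*} (X : Type*) (G : Subgroup (Equiv.Perm ι)) :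
    Setoid (PConf ι X) where
  r x y := ∃ σ ∈ G, ∀ i, y.1 i = x.1 (σ i)
  iseqv :=
    { refl := fun _ => ⟨1, G.one_mem, fun _ => rfl⟩
      symm := by
        rintro x y ⟨σ, hσ, h⟩
        exact ⟨σ⁻¹, G.inv_mem hσ, fun i => by simp [h]⟩
      trans := by
        rintro x y z ⟨σ, hσ, h⟩ ⟨τ, hτ, h'⟩
        exact ⟨σ * τ, G.mul_mem hσ hτ, fun i => by simp [h, h']⟩ }

/-- The quotient `PConf ι X / G`; it carries the quotient topology. -/
abbrev PConfQuot {ι : Type*} (X : Type*) (G : Subgroup (Equiv.Perm ι)) : Type _ :=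
  Quotient (PConf.orbitSetoid X G)

/-- `Conf_n(X) = PConf_n(X) / S_n`, the space of `n` distinct unordered points of `X`. -/
abbrev Conf (n : ℕ) (X : Type*) : Type _ :=
  PConfQuot X (⊤ : Subgroup (Equiv.Perm (Fin n)))

/-- The subgroup `S_n × S_m` of the permutations of the disjoint union of an `n`-element and an
`m`-element set, consisting of the permutations that preserve both parts. -/
abbrev twoColourPerms (n m : ℕ) : Subgroup (Equiv.Perm (Fin n ⊕ Fin m)) :=
  (Equiv.Perm.sumCongrHom (Fin n) (Fin m)).range

/-- `Conf_{n,m}(X) = PConf_{n+m}(X) / (S_n × S_m)`, the space of configurations of `n + m` distinct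
points of `X` divided into `n` old and `m` new points, each group being unordered. -/
abbrev ConfTwo (n m : ℕ) (X : Type*) : Type _ :=
  PConfQuot X (twoColourPerms n m)

/-- The projection `P : Conf_{n,m}(X) → Conf_n(X)` that forgets the `m` new points. -/
def ConfTwo.forget (n m : ℕ) (X : Type*) : ConfTwo n m X → Conf n X :=
  Quotient.map (fun x => ⟨fun i => x.1 (Sum.inl i), x.2.comp Sum.inl_injective⟩) (by
    rintro x y ⟨_, ⟨⟨σ, τ⟩, rfl⟩, h⟩
    exact ⟨σ, Subgroup.mem_top σ, fun i => by simp [h]⟩)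

/-! View `S²` as the projective line of `ℂ²`, so that points are spinors up to scale and `symp`
detects coincidence. In an affine chart with `p` at infinity, the differences of the other `n - 1`
points are determined up to a common factor. The inverse of their product over ordered pairs,
`chartDisc`, is therefore a canonical nonzero element of the `(n - 1)(n - 2)`-th tensor power of the
tangent line at `p`. Ordered pairs avoid a sign ambiguity. Its roots are `(n - 1)(n - 2)` tangent
directions at `p`, on which new points are placed at `k` radii, with `m = n(n - 1)(n - 2)k`.

A continuous shrinking factor keeps all points distinct (`IsFramed.symp_displaced_ne_zero`).
Choosing spinors, roots and an ordering gives a framed family; two choices over the same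
configuration differ by a reframing, which only permutes the new points
(`NewLabels.addPoints_equiv`). Continuity descends because framings can be chosen continuously near
any configuration (`exists_local_section_framedConf`). -/

/-! ### Spinors and the Hopf map -/

/-- The standard symplectic form on `ℂ²`. -/
def symp (v w : ℂ × ℂ) : ℂ := v.1 * w.2 - v.2 * w.1

/-- The squared Hermitian norm on `ℂ²`. -/
def hermSq (v : ℂ × ℂ) : ℝ := Complex.normSq v.1 + Complex.normSq v.2

/-- The quaternionic structure on `ℂ²`. -/
def quatJ (v : ℂ × ℂ) : ℂ × ℂ := (-(starRingEnd ℂ) v.2, (starRingEnd ℂ) v.1)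

/-- The Hopf map from nonzero vectors of `ℂ²` to the unit sphere of `ℝ³`. -/
noncomputable def hopfVec (v : ℂ × ℂ) : EuclideanSpace ℝ (Fin 3) :=
  !₂[2 * (v.1.re * v.2.re + v.1.im * v.2.im) / hermSq v,
     2 * (v.1.re * v.2.im - v.1.im * v.2.re) / hermSq v,
     (Complex.normSq v.1 - Complex.normSq v.2) / hermSq v]

/-- The spin projector `(1 + y · σ) / 2` applied to `v`. -/
noncomputable def spinProj (y : EuclideanSpace ℝ (Fin 3)) (v : ℂ × ℂ) : ℂ × ℂ :=
  (((1 + (y 2 : ℂ)) * v.1 + ((y 0 : ℂ) - (y 1 : ℂ) * Complex.I) * v.2) / 2,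
   (((y 0 : ℂ) + (y 1 : ℂ) * Complex.I) * v.1 + (1 - (y 2 : ℂ)) * v.2) / 2)

theorem hermSq_pos {v : ℂ × ℂ} (hv : v ≠ 0) : 0 < hermSq v := by
  unfold hermSq
  rcases v with ⟨a, b⟩
  by_cases ha : a = 0
  · have hb : b ≠ 0 := by
      rintro rfl
      exact hv (by simp [ha])
    exact add_pos_of_nonneg_of_pos (Complex.normSq_nonneg _) (Complex.normSq_pos.2 hb)
  · exact add_pos_of_pos_of_nonneg (Complex.normSq_pos.2 ha) (Complex.normSq_nonneg _)

theorem ne_zero_of_symp_left {v w : ℂ × ℂ} (h : symp v w ≠ 0) : v ≠ 0 := by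
  rintro rfl
  simp [symp] at h

theorem symp_smul_smul (a b : ℂ) (v w : ℂ × ℂ) : symp (a • v) (b • w) = a * b * symp v w := by
  simp only [symp, Prod.smul_fst, Prod.smul_snd, smul_eq_mul]
  ring

theorem symp_quatJ (v : ℂ × ℂ) : symp v (quatJ v) = (hermSq v : ℂ) := by
  simp only [symp, quatJ, hermSq, Complex.ofReal_add, ← Complex.mul_conj]
  ring

theorem quatJ_smul (a : ℂ) (v : ℂ × ℂ) : quatJ (a • v) = (starRingEnd ℂ) a • quatJ v := by
  ext <;> simp [quatJ]

theorem hermSq_smul (a : ℂ) (v : ℂ × ℂ) : hermSq (a • v) = Complex.normSq a * hermSq v := by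
  simp [hermSq, mul_add]

theorem hopfVec_mem_sphere {v : ℂ × ℂ} (hv : v ≠ 0) :
    hopfVec v ∈ Metric.sphere (0 : EuclideanSpace ℝ (Fin 3)) 1 := by
  have h := (hermSq_pos hv).ne'
  rw [mem_sphere_zero_iff_norm, EuclideanSpace.norm_eq, Real.sqrt_eq_one, Fin.sum_univ_three]
  simp only [hopfVec, Real.norm_eq_abs, sq_abs, Matrix.cons_val]
  field_simp
  simp only [hermSq, Complex.normSq_apply]
  ring

theorem hopfVec_smul {a : ℂ} (ha : a ≠ 0) (v : ℂ × ℂ) : hopfVec (a • v) = hopfVec v := by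
  have h := (Complex.normSq_pos.2 ha).ne'
  have key : ∀ x y : ℝ, x = Complex.normSq a * y → x / hermSq (a • v) = y / hermSq v := by
    rintro x y rfl
    rw [hermSq_smul, mul_div_mul_left _ _ h]
  unfold hopfVec
  congr 1
  congr 1
  · apply key
    simp [Complex.normSq_apply]
    ring
  · congr 1
    · apply key
      simp [Complex.normSq_apply]
      ring
    · congr 1
      apply key
      simp [Complex.normSq_apply]
      ring

theorem symp_eq_zero_of_hopfVec_eq {v w : ℂ × ℂ} (hv : v ≠ 0) (hw : w ≠ 0)
    (h : hopfVec v = hopfVec w) : symp v w = 0 := by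
  have h1 := (hermSq_pos hv).ne'
  have h2 := (hermSq_pos hw).ne'
  have hn := EuclideanSpace.norm_eq (hopfVec v)
  rw [mem_sphere_zero_iff_norm.1 (hopfVec_mem_sphere hv), eq_comm, Real.sqrt_eq_one,
    Fin.sum_univ_three] at hn
  simp only [Real.norm_eq_abs, sq_abs] at hn
  have e : hopfVec v 0 * hopfVec w 0 + hopfVec v 1 * hopfVec w 1 + hopfVec v 2 * hopfVec w 2
      = 1 := by
    rw [← h, ← hn]
    ring
  simp only [hopfVec, PiLp.toLp_apply, Matrix.cons_val] at e
  field_simp at e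
  rw [← Complex.normSq_eq_zero]
  -- This is `2|symp v w|² = |v|²|w|²(1 - ⟨hopfVec v, hopfVec w⟩)`, where the inner product is `1`
  -- by `e`.
  have : Complex.normSq (symp v w) * 2 = hermSq v * hermSq w - hermSq v * hermSq w := by
    nth_rw 2 [← e]
    simp only [symp, hermSq, Complex.normSq_apply, Complex.sub_re, Complex.sub_im, Complex.mul_re,
      Complex.mul_im]
    ring
  linarith

theorem exists_smul_of_symp_eq_zero {v w : ℂ × ℂ} (hv : v ≠ 0) (hw : w ≠ 0)
    (h : symp v w = 0) : ∃ a : ℂ, a ≠ 0 ∧ w = a • v := by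
  have : ∃ a : ℂ, w = a • v := by
    rcases v with ⟨a, b⟩
    rcases w with ⟨c, d⟩
    simp only [symp] at h
    by_cases ha : a = 0
    · have hb : b ≠ 0 := by
        rintro rfl
        exact hv (by simp [ha])
      refine ⟨d / b, ?_⟩
      have hc : c = 0 := by simpa [ha, hb] using h
      ext <;> simp [ha, hb, hc]
    · refine ⟨c / a, ?_⟩
      ext
      · simp [ha]
      · simp only [Prod.smul_snd, smul_eq_mul]
        field_simp
        linear_combination h
  obtain ⟨a, rfl⟩ := this
  refine ⟨a, ?_, rfl⟩
  rintro rfl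
  simp at hw

theorem spinProj_hopfVec {v : ℂ × ℂ} (hv : v ≠ 0) : spinProj (hopfVec v) v = v := by
  have h := (hermSq_pos hv).ne'
  ext
  · simp only [spinProj, hopfVec, PiLp.toLp_apply, Matrix.cons_val]
    apply Complex.ext
    · simp [-Complex.ofReal_mul, -Complex.ofReal_add, -Complex.ofReal_sub, -Complex.ofReal_div]
      field_simp
      simp only [hermSq, Complex.normSq_apply]
      ring
    · simp [-Complex.ofReal_mul, -Complex.ofReal_add, -Complex.ofReal_sub, -Complex.ofReal_div]
      field_simp
      simp only [hermSq, Complex.normSq_apply]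
      ring
  · simp only [spinProj, hopfVec, PiLp.toLp_apply, Matrix.cons_val]
    apply Complex.ext
    · simp [-Complex.ofReal_mul, -Complex.ofReal_add, -Complex.ofReal_sub, -Complex.ofReal_div]
      field_simp
      simp only [hermSq, Complex.normSq_apply]
      ring
    · simp [-Complex.ofReal_mul, -Complex.ofReal_add, -Complex.ofReal_sub, -Complex.ofReal_div]
      field_simp
      simp only [hermSq, Complex.normSq_apply]
      ring

theorem sq_sum_of_mem_sphere {y : EuclideanSpace ℝ (Fin 3)}
    (hy : y ∈ Metric.sphere (0 : EuclideanSpace ℝ (Fin 3)) 1) :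
    y 0 ^ 2 + y 1 ^ 2 + y 2 ^ 2 = 1 := by
  rw [mem_sphere_zero_iff_norm, EuclideanSpace.norm_eq, Real.sqrt_eq_one,
    Fin.sum_univ_three] at hy
  simpa only [Real.norm_eq_abs, sq_abs] using hy

/-- The Pauli matrices give `(y · σ)² = |y|² = 1`. -/
theorem spinProj_spinProj {y : EuclideanSpace ℝ (Fin 3)}
    (hy : y ∈ Metric.sphere (0 : EuclideanSpace ℝ (Fin 3)) 1) (v : ℂ × ℂ) :
    spinProj y (spinProj y v) = spinProj y v := by
  have h : (y 0 : ℂ) ^ 2 + (y 1 : ℂ) ^ 2 + (y 2 : ℂ) ^ 2 = 1 := by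
    rw [← Complex.ofReal_one, ← sq_sum_of_mem_sphere hy]
    push_cast
    rfl
  ext
  · simp only [spinProj]
    linear_combination (v.1 / 4) * h - v.1 * (y 1 : ℂ) ^ 2 / 4 * Complex.I_sq
  · simp only [spinProj]
    linear_combination (v.2 / 4) * h - v.2 * (y 1 : ℂ) ^ 2 / 4 * Complex.I_sq

/-- The coordinates of `hopfVec w` are the normalized expectations of the Pauli matrices `σᵢ`. Since
`(y · σ) w = w` and the anticommutator of `σᵢ` and `y · σ` is `2 yᵢ`, they equal `yᵢ`. -/
theorem hopfVec_eq_of_spinProj_eq {y : EuclideanSpace ℝ (Fin 3)} {w : ℂ × ℂ} (hw : w ≠ 0)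
    (h : spinProj y w = w) : hopfVec w = y := by
  have hs := (hermSq_pos hw).ne'
  have h1 := congrArg Prod.fst h
  have h2 := congrArg Prod.snd h
  simp only [spinProj] at h1 h2
  rw [div_eq_iff two_ne_zero] at h1 h2
  have h1r := congrArg Complex.re h1
  have h1i := congrArg Complex.im h1
  have h2r := congrArg Complex.re h2
  have h2i := congrArg Complex.im h2
  simp at h1r h1i h2r h2i
  ext i
  fin_cases i
  · simp only [hopfVec, PiLp.toLp_apply, Matrix.cons_val, Fin.zero_eta]
    rw [div_eq_iff hs]
    simp only [hermSq, Complex.normSq_apply]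
    linear_combination -w.1.re * h2r - w.1.im * h2i - w.2.re * h1r - w.2.im * h1i
  · simp only [hopfVec, PiLp.toLp_apply, Matrix.cons_val, Fin.mk_one]
    rw [div_eq_iff hs]
    simp only [hermSq, Complex.normSq_apply]
    linear_combination -w.1.re * h2i + w.1.im * h2r - w.2.im * h1r + w.2.re * h1i
  · simp only [hopfVec, PiLp.toLp_apply, Matrix.cons_val, Fin.reduceFinMk]
    rw [div_eq_iff hs]
    simp only [hermSq, Complex.normSq_apply]
    linear_combination -w.1.re * h1r - w.1.im * h1i + w.2.re * h2r + w.2.im * h2i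

theorem exists_hopfVec_eq (y : TwoSphere) : ∃ v : ℂ × ℂ, v ≠ 0 ∧ hopfVec v = y.1 := by
  have key : ∀ v : ℂ × ℂ, spinProj y.1 v ≠ 0 → ∃ v : ℂ × ℂ, v ≠ 0 ∧ hopfVec v = y.1 :=
    fun v hv => ⟨_, hv, hopfVec_eq_of_spinProj_eq hv (spinProj_spinProj y.2 v)⟩
  by_contra hcon
  have h1 : spinProj y.1 (1, 0) = 0 := by_contra fun h => hcon (key _ h)
  have h2 : spinProj y.1 (0, 1) = 0 := by_contra fun h => hcon (key _ h)
  have h1' := congrArg Prod.fst h1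
  have h2' := congrArg Prod.snd h2
  simp [spinProj] at h1' h2'
  -- The projector has trace `1`, so it cannot kill both basis vectors.
  have : (2 : ℂ) = 0 := by linear_combination h1' + h2'
  norm_num at this

/-! ### Continuity of the spinor operations -/

theorem continuous_symp : Continuous fun p : (ℂ × ℂ) × (ℂ × ℂ) => symp p.1 p.2 := by
  unfold symp
  fun_prop

theorem continuous_hermSq : Continuous hermSq := by
  unfold hermSq
  exact (Complex.continuous_normSq.comp continuous_fst).add
    (Complex.continuous_normSq.comp continuous_snd)

theorem continuous_quatJ : Continuous quatJ := by
  unfold quatJ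
  exact ((Complex.continuous_conj.comp continuous_snd).neg).prodMk
    (Complex.continuous_conj.comp continuous_fst)

theorem Continuous.hopfVec {T : Type*} [TopologicalSpace T] {f : T → ℂ × ℂ} (hf : Continuous f)
    (h0 : ∀ t, f t ≠ 0) : Continuous fun t => hopfVec (f t) := by
  have hs : ∀ t, hermSq (f t) ≠ 0 := fun t => (hermSq_pos (h0 t)).ne'
  have hd := continuous_hermSq.comp hf
  unfold _root_.hopfVec
  refine (PiLp.continuous_toLp 2 _).comp (continuous_pi fun i => ?_)
  have hn1 := Complex.continuous_normSq.comp (continuous_fst.comp hf)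
  have hn2 := Complex.continuous_normSq.comp (continuous_snd.comp hf)
  fin_cases i
  · exact Continuous.div (by fun_prop) hd hs
  · exact Continuous.div (by fun_prop) hd hs
  · exact Continuous.div (hn1.sub hn2) hd hs

theorem continuous_spinProj (v : ℂ × ℂ) : Continuous fun y => spinProj y v := by
  unfold spinProj
  fun_prop

/-! ### Canonical tangent directions and displaced points -/

open Finset in
/-- The product over ordered pairs `(q, r)` of indices distinct from `p` and from each other of the
inverses of the differences of the points `q` and `r` in an affine chart with `p` at infinity. -/
noncomputable def chartDisc {n : ℕ} (ψ : Fin n → ℂ × ℂ) (p : Fin n) : ℂ :=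
  ∏ q ∈ univ.erase p, ∏ r ∈ (univ.erase p).erase q,
    symp (ψ p) (ψ q) * symp (ψ p) (ψ r) / symp (ψ q) (ψ r)

/-- A family of spinors representing distinct points, together with a root of `chartDisc` at each
of them. -/
def IsFramed {n : ℕ} (z : (Fin n → ℂ × ℂ) × (Fin n → ℂ)) : Prop :=
  (∀ p q, p ≠ q → symp (z.1 p) (z.1 q) ≠ 0) ∧
    ∀ p, z.2 p ^ ((n - 1) * (n - 2)) = chartDisc z.1 p

/-- The vector transverse to `z.1 p` along which the point `p` is displaced. -/
noncomputable def pushVec {n : ℕ} (z : (Fin n → ℂ × ℂ) × (Fin n → ℂ)) (p : Fin n) : ℂ × ℂ :=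
  (z.2 p / (hermSq (z.1 p) : ℂ)) • quatJ (z.1 p)

/-- The size of the displacements at `p` and `q` relative to the distance of these points. -/
noncomputable def pushRatio {n : ℕ} (z : (Fin n → ℂ × ℂ) × (Fin n → ℂ)) (p q : Fin n) : ℝ :=
  (‖symp (pushVec z p) (z.1 q)‖ + ‖symp (z.1 p) (pushVec z q)‖ +
    ‖symp (pushVec z p) (pushVec z q)‖) / ‖symp (z.1 p) (z.1 q)‖

open Finset in
/-- A factor by which all displacements are shrunk so that the displaced points stay distinct. -/
noncomputable def shrink {n : ℕ} (z : (Fin n → ℂ × ℂ) × (Fin n → ℂ)) : ℝ :=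
  (1 + ∑ p, ∑ q ∈ univ.erase p, pushRatio z p q)⁻¹

/-- The point `p` displaced by the multiple `c` of its shrunk displacement vector. -/
noncomputable def displaced {n : ℕ} (z : (Fin n → ℂ × ℂ) × (Fin n → ℂ)) (p : Fin n) (c : ℂ) :
    ℂ × ℂ :=
  z.1 p + ((shrink z : ℂ) * c) • pushVec z p

section

variable {n : ℕ} {z z' : (Fin n → ℂ × ℂ) × (Fin n → ℂ)}

theorem pushRatio_nonneg (z : (Fin n → ℂ × ℂ) × (Fin n → ℂ)) (p q : Fin n) :
    0 ≤ pushRatio z p q := by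
  unfold pushRatio
  positivity

theorem sum_pushRatio_nonneg (z : (Fin n → ℂ × ℂ) × (Fin n → ℂ)) :
    0 ≤ ∑ p, ∑ q ∈ Finset.univ.erase p, pushRatio z p q :=
  Finset.sum_nonneg fun _ _ => Finset.sum_nonneg fun _ _ => pushRatio_nonneg _ _ _

theorem shrink_pos (z : (Fin n → ℂ × ℂ) × (Fin n → ℂ)) : 0 < shrink z :=
  inv_pos.2 (by linarith [sum_pushRatio_nonneg z])

theorem shrink_le_one (z : (Fin n → ℂ × ℂ) × (Fin n → ℂ)) : shrink z ≤ 1 :=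
  inv_le_one_of_one_le₀ (by linarith [sum_pushRatio_nonneg z])

theorem shrink_mul_pushRatio_lt_one {p q : Fin n} (hpq : p ≠ q) :
    shrink z * pushRatio z p q < 1 := by
  have h1 : pushRatio z p q ≤ ∑ p, ∑ q ∈ Finset.univ.erase p, pushRatio z p q :=
    (Finset.single_le_sum (f := fun q => pushRatio z p q) (fun _ _ => pushRatio_nonneg _ _ _)
      (Finset.mem_erase.2 ⟨hpq.symm, Finset.mem_univ q⟩)).trans
      (Finset.single_le_sum (f := fun p => ∑ q ∈ Finset.univ.erase p, pushRatio z p q)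
        (fun _ _ => Finset.sum_nonneg fun _ _ => pushRatio_nonneg _ _ _) (Finset.mem_univ p))
  unfold shrink
  rw [inv_mul_lt_iff₀ (by linarith [sum_pushRatio_nonneg z])]
  linarith

theorem IsFramed.chartDisc_ne_zero (hz : IsFramed z) (p : Fin n) : chartDisc z.1 p ≠ 0 := by
  refine Finset.prod_ne_zero_iff.2 fun q hq => Finset.prod_ne_zero_iff.2 fun r hr => ?_
  simp only [Finset.mem_erase, Finset.mem_univ, and_true] at hq hr
  exact div_ne_zero (mul_ne_zero (hz.1 _ _ hq.symm) (hz.1 _ _ hr.2.symm)) (hz.1 _ _ hr.1.symm)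

theorem exists_ne_fin (hn : 3 ≤ n) (p : Fin n) : ∃ q, p ≠ q := by
  have : Nontrivial (Fin n) := Fin.nontrivial_iff_two_le.2 (by omega)
  obtain ⟨q, hq⟩ := exists_ne p
  exact ⟨q, hq.symm⟩

theorem IsFramed.fst_ne_zero (hn : 3 ≤ n) (hz : IsFramed z) (p : Fin n) : z.1 p ≠ 0 := by
  obtain ⟨q, hq⟩ := exists_ne_fin hn p
  exact ne_zero_of_symp_left (hz.1 p q hq)

theorem exponent_ne_zero (hn : 3 ≤ n) : (n - 1) * (n - 2) ≠ 0 :=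
  Nat.mul_ne_zero (by omega) (by omega)

theorem IsFramed.snd_ne_zero (hn : 3 ≤ n) (hz : IsFramed z) (p : Fin n) : z.2 p ≠ 0 := by
  intro h
  have := hz.2 p
  rw [h, zero_pow (exponent_ne_zero hn)] at this
  exact hz.chartDisc_ne_zero p this.symm

theorem symp_fst_pushVec {p : Fin n} (h : z.1 p ≠ 0) : symp (z.1 p) (pushVec z p) = z.2 p := by
  have h' : (hermSq (z.1 p) : ℂ) ≠ 0 := by exact_mod_cast (hermSq_pos h).ne'
  have := symp_smul_smul 1 (z.2 p / (hermSq (z.1 p) : ℂ)) (z.1 p) (quatJ (z.1 p))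
  rw [one_smul, symp_quatJ] at this
  rw [pushVec, this]
  field_simp

theorem symp_add_smul_add_smul (a b : ℂ) (v w v' w' : ℂ × ℂ) :
    symp (v + a • w) (v' + b • w') =
      symp v v' + (a * symp w v' + b * symp v w' + a * b * symp w w') := by
  simp only [symp, Prod.fst_add, Prod.snd_add, Prod.smul_fst, Prod.smul_snd, smul_eq_mul]
  ring

/-- At a common base point the pairing is a nonzero multiple of `d - c`. At different ones it is
`symp (z.1 p) (z.1 q)` plus an error that `shrink` makes strictly smaller in norm. -/
theorem IsFramed.symp_displaced_ne_zero (hn : 3 ≤ n) (hz : IsFramed z) {p q : Fin n} {c d : ℂ}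
    (hc : ‖c‖ ≤ 1) (hd : ‖d‖ ≤ 1) (h : p = q → c ≠ d) :
    symp (displaced z p c) (displaced z q d) ≠ 0 := by
  unfold displaced
  rw [symp_add_smul_add_smul]
  by_cases hpq : p = q
  · subst hpq
    have h1 := symp_fst_pushVec (hz.fst_ne_zero hn p)
    have h2 : symp (pushVec z p) (z.1 p) = -z.2 p := by
      rw [← h1]
      unfold symp
      ring
    have h3 : ∀ v, symp v v = 0 := fun v => by
      unfold symp
      ring
    rw [h1, h2, h3, h3]
    have : (0 : ℂ) + (shrink z * c * -z.2 p + shrink z * d * z.2 p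
        + shrink z * c * (shrink z * d) * 0) = shrink z * z.2 p * (d - c) := by
      ring
    rw [this]
    exact mul_ne_zero (mul_ne_zero (by exact_mod_cast (shrink_pos z).ne') (hz.snd_ne_zero hn p))
      (sub_ne_zero.2 (h rfl).symm)
  · intro h0
    have hw : 0 < ‖symp (z.1 p) (z.1 q)‖ := norm_pos_iff.2 (hz.1 p q hpq)
    have hlt := shrink_mul_pushRatio_lt_one (z := z) hpq
    unfold pushRatio at hlt
    rw [← mul_div_assoc, div_lt_one hw] at hlt
    have ht := shrink_pos z
    have hnt : ‖(shrink z : ℂ)‖ = shrink z := by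
      rw [Complex.norm_real, Real.norm_of_nonneg ht.le]
    have hA : ‖(shrink z : ℂ) * c‖ ≤ shrink z := by
      rw [norm_mul, hnt]
      exact mul_le_of_le_one_right ht.le hc
    have hB : ‖(shrink z : ℂ) * d‖ ≤ shrink z := by
      rw [norm_mul, hnt]
      exact mul_le_of_le_one_right ht.le hd
    -- The quadratic term obeys the same linear bound because `shrink z ≤ 1`.
    have hAB : ‖(shrink z : ℂ) * c * (shrink z * d)‖ ≤ shrink z := by
      rw [norm_mul]
      calc _ ≤ shrink z * 1 := mul_le_mul hA (hB.trans (shrink_le_one z)) (norm_nonneg _) ht.le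
        _ = shrink z := mul_one _
    rw [eq_neg_of_add_eq_zero_left h0, norm_neg] at hlt
    refine absurd hlt (not_lt.2 ((norm_add₃_le).trans ?_))
    rw [norm_mul, norm_mul _ (symp (z.1 p) _), norm_mul _ (symp (pushVec z p) (pushVec z q)),
      mul_add, mul_add]
    gcongr

theorem displaced_zero (z : (Fin n → ℂ × ℂ) × (Fin n → ℂ)) (p : Fin n) :
    displaced z p 0 = z.1 p := by
  simp [displaced]

/-- Each factor has weight two in the spinor at `p` and weight zero in those at `q` and `r`. Hence
the roots scale by `l p ^ 2` up to a root of unity. -/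
theorem chartDisc_smul_perm {l : Fin n → ℂ} {σ : Equiv.Perm (Fin n)} {ψ ψ' : Fin n → ℂ × ℂ}
    (hl : ∀ p, l p ≠ 0) (h : ∀ p, ψ' p = l p • ψ (σ p)) (p : Fin n) :
    chartDisc ψ' p = (l p ^ 2) ^ ((n - 1) * (n - 2)) * chartDisc ψ (σ p) := by
  have hconst : (l p ^ 2) ^ ((n - 1) * (n - 2)) =
      ∏ q ∈ Finset.univ.erase p, ∏ r ∈ (Finset.univ.erase p).erase q, l p ^ 2 := by
    rw [Finset.prod_congr rfl (g := fun _ => (l p ^ 2) ^ (n - 2))]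
    · rw [Finset.prod_const, Finset.card_erase_of_mem (Finset.mem_univ p), Finset.card_univ,
        Fintype.card_fin, mul_comm (n - 1), pow_mul]
    · intro q hq
      rw [Finset.prod_const, Finset.card_erase_of_mem hq,
        Finset.card_erase_of_mem (Finset.mem_univ p), Finset.card_univ, Fintype.card_fin,
        Nat.sub_sub]
  have hre : chartDisc ψ (σ p) =
      ∏ q ∈ Finset.univ.erase p, ∏ r ∈ (Finset.univ.erase p).erase q,
        symp (ψ (σ p)) (ψ (σ q)) * symp (ψ (σ p)) (ψ (σ r)) / symp (ψ (σ q)) (ψ (σ r)) := by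
    unfold chartDisc
    symm
    refine Finset.prod_equiv σ (by simp) fun q _ => ?_
    exact Finset.prod_equiv σ (by simp) fun r _ => rfl
  rw [hconst, hre, ← Finset.prod_mul_distrib]
  refine Finset.prod_congr rfl fun q _ => ?_
  rw [← Finset.prod_mul_distrib]
  refine Finset.prod_congr rfl fun r _ => ?_
  rw [h, h, h, symp_smul_smul, symp_smul_smul, symp_smul_smul]
  rw [← mul_div_assoc, show l p * l q * symp (ψ (σ p)) (ψ (σ q)) *
    (l p * l r * symp (ψ (σ p)) (ψ (σ r))) = l q * l r *
      (l p ^ 2 * (symp (ψ (σ p)) (ψ (σ q)) * symp (ψ (σ p)) (ψ (σ r)))) by ring,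
    mul_div_mul_left _ _ (mul_ne_zero (hl q) (hl r))]

/-! ### Dependence on the framing -/

/-- `z'` arises from `z` by relabelling along `σ`, rescaling the spinors by `l` and changing the
roots by the phases `ζ`. -/
def IsReframing (σ : Equiv.Perm (Fin n)) (l ζ : Fin n → ℂ)
    (z z' : (Fin n → ℂ × ℂ) × (Fin n → ℂ)) : Prop :=
  ∀ p, l p ≠ 0 ∧ ‖ζ p‖ = 1 ∧ z'.1 p = l p • z.1 (σ p) ∧ z'.2 p = ζ p * l p ^ 2 * z.2 (σ p)

variable {σ : Equiv.Perm (Fin n)} {l ζ : Fin n → ℂ}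

/-- The weight `l p ^ 2` of the root, the conjugate weight of `quatJ` and the weight `|l p|²` of the
norm combine to `l p`, so the push vector scales like the spinor, up to the phase `ζ p`. -/
theorem IsReframing.pushVec (h : IsReframing σ l ζ z z') (p : Fin n) :
    pushVec z' p = (l p * ζ p) • pushVec z (σ p) := by
  obtain ⟨hl, -, h1, h2⟩ := h p
  unfold _root_.pushVec
  rw [h1, h2, quatJ_smul, hermSq_smul, smul_smul, smul_smul]
  congr 1
  rw [Complex.ofReal_mul, ← Complex.mul_conj]
  have : (starRingEnd ℂ) (l p) ≠ 0 := (map_ne_zero _).2 hl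
  -- No framing is assumed here, so the spinor may vanish; both sides are then zero.
  by_cases h0 : (hermSq (z.1 (σ p)) : ℂ) = 0
  · simp [h0]
  · field_simp

theorem IsReframing.pushRatio (h : IsReframing σ l ζ z z') (p q : Fin n) :
    pushRatio z' p q = pushRatio z (σ p) (σ q) := by
  have hp : 0 < ‖l p‖ := norm_pos_iff.2 (h p).1
  have hq : 0 < ‖l q‖ := norm_pos_iff.2 (h q).1
  unfold _root_.pushRatio
  rw [h.pushVec, h.pushVec, (h p).2.2.1, (h q).2.2.1]
  simp only [symp_smul_smul, norm_mul, (h p).2.1, (h q).2.1, mul_one]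
  rw [← mul_add, ← mul_add, mul_div_mul_left _ _ (mul_pos hp hq).ne']

theorem IsReframing.shrink (h : IsReframing σ l ζ z z') : shrink z' = shrink z := by
  unfold _root_.shrink
  congr 2
  refine Finset.sum_equiv σ (by simp) fun p _ => Finset.sum_equiv σ (by simp) fun q _ => ?_
  exact h.pushRatio p q

theorem IsReframing.displaced (h : IsReframing σ l ζ z z') (p : Fin n) (c : ℂ) :
    displaced z' p c = l p • displaced z (σ p) (ζ p * c) := by
  unfold _root_.displaced
  rw [h.shrink, h.pushVec, (h p).2.2.1, smul_add, smul_smul, smul_smul]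
  congr 2
  ring

theorem IsFramed.exists_isReframing (hn : 3 ≤ n) (hz : IsFramed z) (hz' : IsFramed z')
    (h : ∀ p, hopfVec (z'.1 p) = hopfVec (z.1 (σ p))) :
    ∃ l ζ : Fin n → ℂ, IsReframing σ l ζ z z' ∧ ∀ p, ζ p ^ ((n - 1) * (n - 2)) = 1 := by
  have hex : ∀ p, ∃ a : ℂ, a ≠ 0 ∧ z'.1 p = a • z.1 (σ p) := fun p =>
    exists_smul_of_symp_eq_zero (hz.fst_ne_zero hn _) (hz'.fst_ne_zero hn _)
      (symp_eq_zero_of_hopfVec_eq (hz.fst_ne_zero hn _) (hz'.fst_ne_zero hn _) (h p).symm)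
  choose l hl hl' using hex
  have hζ : ∀ p, (z'.2 p / (l p ^ 2 * z.2 (σ p))) ^ ((n - 1) * (n - 2)) = 1 := fun p => by
    rw [div_pow, mul_pow, hz.2, hz'.2, chartDisc_smul_perm hl hl', div_self]
    exact mul_ne_zero (pow_ne_zero _ (pow_ne_zero _ (hl p))) (hz.chartDisc_ne_zero _)
  refine ⟨l, fun p => z'.2 p / (l p ^ 2 * z.2 (σ p)), fun p => ⟨hl p, ?_, hl' p, ?_⟩, hζ⟩
  · exact Complex.norm_eq_one_of_pow_eq_one (hζ p) (exponent_ne_zero hn)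
  · have := hl p
    have := hz.snd_ne_zero hn (σ p)
    field_simp

end

/-! ### Continuity and local choice of framings -/

theorem continuous_pushVec {n : ℕ} (hn : 3 ≤ n) (p : Fin n) :
    Continuous fun z : {z : (Fin n → ℂ × ℂ) × (Fin n → ℂ) // IsFramed z} => pushVec z.1 p := by
  have h1 : Continuous fun z : {z : (Fin n → ℂ × ℂ) × (Fin n → ℂ) // IsFramed z} => z.1.1 p := by
    fun_prop
  have h2 : Continuous fun z : {z : (Fin n → ℂ × ℂ) × (Fin n → ℂ) // IsFramed z} => z.1.2 p := by
    fun_prop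
  refine Continuous.smul (h2.div (Complex.continuous_ofReal.comp (continuous_hermSq.comp h1))
    fun z => ?_) (continuous_quatJ.comp h1)
  exact Complex.ofReal_ne_zero.2 (hermSq_pos (z.2.fst_ne_zero hn p)).ne'

theorem continuous_displaced {n : ℕ} (hn : 3 ≤ n) (p : Fin n) (c : ℂ) :
    Continuous fun z : {z : (Fin n → ℂ × ℂ) × (Fin n → ℂ) // IsFramed z} =>
      displaced z.1 p c := by
  have h1 : ∀ p, Continuous
      fun z : {z : (Fin n → ℂ × ℂ) × (Fin n → ℂ) // IsFramed z} => z.1.1 p := by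
    intro p
    fun_prop
  have h2 := continuous_pushVec hn
  have hs : ∀ {f g : {z : (Fin n → ℂ × ℂ) × (Fin n → ℂ) // IsFramed z} → ℂ × ℂ},
      Continuous f → Continuous g → Continuous fun z => ‖symp (f z) (g z)‖ :=
    fun hf hg => (continuous_symp.comp (hf.prodMk hg)).norm
  have ht : Continuous
      fun z : {z : (Fin n → ℂ × ℂ) × (Fin n → ℂ) // IsFramed z} => shrink z.1 := by
    refine Continuous.inv₀ (continuous_const.add (continuous_finsetSum _ fun p _ =>
      continuous_finsetSum _ fun q hq => ?_)) fun z => ?_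
    · refine Continuous.div (((hs (h2 p) (h1 q)).add (hs (h1 p) (h2 q))).add (hs (h2 p) (h2 q)))
        (hs (h1 p) (h1 q)) fun z => ?_
      exact norm_ne_zero_iff.2 (z.2.1 p q (Finset.ne_of_mem_erase hq).symm)
    · exact (inv_pos.1 (shrink_pos z.1)).ne'
  exact (h1 p).add (Continuous.smul ((Complex.continuous_ofReal.comp ht).mul continuous_const)
    (h2 p))

/-- A function on the base of a surjection with local right inverses is continuous if its pullback is. -/
theorem continuous_of_local_sections {Z B Y : Type*} [TopologicalSpace Z] [TopologicalSpace B]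
    [TopologicalSpace Y] {π : Z → B} (hπ : Function.Surjective π)
    (hs : ∀ z, ∃ s : B → Z, ContinuousAt s (π z) ∧ ∀ᶠ b in nhds (π z), π (s b) = b)
    {f : B → Y} (hf : Continuous (f ∘ π)) : Continuous f := by
  refine continuous_iff_continuousAt.2 fun b => ?_
  obtain ⟨z, rfl⟩ := hπ b
  obtain ⟨s, hs1, hs3⟩ := hs z
  have h : ContinuousAt (f ∘ π ∘ s) (π z) := hf.continuousAt.comp hs1
  refine h.congr ?_
  filter_upwards [hs3] with b hb
  simp [hb]

/-- The ordered configuration represented by a framed family. -/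
noncomputable def framedConf {n : ℕ} (hn : 3 ≤ n)
    (z : {z : (Fin n → ℂ × ℂ) × (Fin n → ℂ) // IsFramed z}) : PConf (Fin n) TwoSphere :=
  ⟨fun p => ⟨hopfVec (z.1.1 p), hopfVec_mem_sphere (z.2.fst_ne_zero hn p)⟩, fun p q h => by
    by_contra hpq
    exact z.2.1 p q hpq (symp_eq_zero_of_hopfVec_eq (z.2.fst_ne_zero hn p)
      (z.2.fst_ne_zero hn q) (congrArg Subtype.val h))⟩

theorem framedConf_surjective {n : ℕ} (hn : 3 ≤ n) : Function.Surjective (framedConf hn) := by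
  intro x
  choose ψ h0 hψ using fun p => exists_hopfVec_eq (x.1 p)
  have hne : ∀ p q, p ≠ q → symp (ψ p) (ψ q) ≠ 0 := fun p q hpq h => by
    obtain ⟨a, ha, hq⟩ := exists_smul_of_symp_eq_zero (h0 p) (h0 q) h
    refine hpq (x.2 (Subtype.ext ?_))
    rw [← hψ p, ← hψ q, hq, hopfVec_smul ha]
  choose ρ hρ using fun p =>
    IsAlgClosed.exists_pow_nat_eq (chartDisc ψ p) (Nat.pos_of_ne_zero (exponent_ne_zero hn))
  exact ⟨⟨(ψ, ρ), hne, hρ⟩, Subtype.ext (funext fun p => Subtype.ext (hψ p))⟩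

theorem exists_local_root {N : ℕ} (hN : N ≠ 0) {ρ : ℂ} (hρ : ρ ≠ 0) :
    ∃ r : ℂ → ℂ, ContinuousAt r (ρ ^ N) ∧ ∀ w, r w ^ N = w := by
  have h0 : ρ ^ N ≠ 0 := pow_ne_zero _ hρ
  -- Dividing by `ρ ^ N` moves the base point to `1`, off the branch cut of the principal power.
  refine ⟨fun w => ρ * (w / ρ ^ N) ^ ((N : ℂ)⁻¹), ?_, fun w => ?_⟩
  · refine continuousAt_const.mul (ContinuousAt.cpow (continuousAt_id.div_const _)
      continuousAt_const ?_)
    simp [div_self h0]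
  · rw [mul_pow, Complex.cpow_nat_inv_pow _ hN]
    field_simp

theorem exists_local_section_framedConf {n : ℕ} (hn : 3 ≤ n)
    (z : {z : (Fin n → ℂ × ℂ) × (Fin n → ℂ) // IsFramed z}) :
    ∃ s : PConf (Fin n) TwoSphere → {z : (Fin n → ℂ × ℂ) × (Fin n → ℂ) // IsFramed z},
      ContinuousAt s (framedConf hn z) ∧
        ∀ᶠ x in nhds (framedConf hn z), framedConf hn (s x) = x := by
  classical
  set x₀ := framedConf hn z
  choose r hrc hr using fun p =>
    exists_local_root (exponent_ne_zero hn) (z.2.snd_ne_zero hn p)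
  -- Projecting the fixed spinor of `z` to the line of the moving point lifts that point
  -- continuously, as long as the projection is nonzero.
  let Ψ : PConf (Fin n) TwoSphere → Fin n → ℂ × ℂ := fun x p => spinProj (x.1 p).1 (z.1.1 p)
  have hΨ : Continuous Ψ := continuous_pi fun p => (continuous_spinProj _).comp
    (continuous_subtype_val.comp ((continuous_apply p).comp continuous_subtype_val))
  have hΨ0 : Ψ x₀ = z.1.1 := funext fun p => spinProj_hopfVec (z.2.fst_ne_zero hn p)
  let Θ : PConf (Fin n) TwoSphere → (Fin n → ℂ × ℂ) × (Fin n → ℂ) :=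
    fun x => (Ψ x, fun p => r p (chartDisc (Ψ x) p))
  have hsymp : ∀ p q, Continuous fun x => symp (Ψ x p) (Ψ x q) := fun p q =>
    continuous_symp.comp (((continuous_apply p).comp hΨ).prodMk ((continuous_apply q).comp hΨ))
  have hne0 : ∀ p q, p ≠ q → symp (Ψ x₀ p) (Ψ x₀ q) ≠ 0 := fun p q hpq => by
    rw [hΨ0]
    exact z.2.1 p q hpq
  have hΘc : ContinuousAt Θ x₀ := by
    refine hΨ.continuousAt.prodMk (continuousAt_pi.2 fun p => ?_)
    refine ContinuousAt.comp (g := r p) (f := fun x => chartDisc (Ψ x) p) ?_ ?_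
    · rw [hΨ0, ← z.2.2 p]
      exact hrc p
    · refine tendsto_finsetProd _ fun q hq => tendsto_finsetProd _ fun s hs => ?_
      exact (((hsymp p q).mul (hsymp p s)).continuousAt).div (hsymp q s).continuousAt
        (hne0 q s (Finset.ne_of_mem_erase hs).symm)
  have hgood : ∀ᶠ x in nhds x₀, IsFramed (Θ x) := by
    have : ∀ᶠ x in nhds x₀, ∀ p q, p ≠ q → symp (Ψ x p) (Ψ x q) ≠ 0 := by
      simp only [Filter.eventually_all]
      exact fun p q hpq => (hsymp p q).continuousAt.eventually_ne (hne0 p q hpq)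
    filter_upwards [this] with x hx
    exact ⟨hx, fun p => hr p _⟩
  -- The value `z` is a dummy: near `x₀` the first branch always applies.
  refine ⟨fun x => if h : IsFramed (Θ x) then ⟨Θ x, h⟩ else z, ?_, ?_⟩
  · refine Topology.IsInducing.subtypeVal.continuousAt_iff.2 (hΘc.congr ?_)
    filter_upwards [hgood] with x hx
    change _ = (if h : IsFramed (Θ x) then
      (⟨Θ x, h⟩ : {z : (Fin n → ℂ × ℂ) × (Fin n → ℂ) // IsFramed z}) else z).1
    rw [dif_pos hx]
  · filter_upwards [hgood] with x hx
    rw [dif_pos hx]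
    refine Subtype.ext (funext fun p => Subtype.ext ?_)
    exact hopfVec_eq_of_spinProj_eq (hx.fst_ne_zero hn p) (spinProj_spinProj (x.1 p).2 _)

/-! ### Labels of the new points -/

/-- Labels of new points by an old point and a coefficient in the unit disc, invariant under the
permutations of the old points and the multiplications of coefficients by roots of unity. -/
structure NewLabels (n m : ℕ) where
  base : Fin m → Fin n
  coef : Fin m → ℂ
  coef_ne_zero : ∀ j, coef j ≠ 0
  norm_coef_le : ∀ j, ‖coef j‖ ≤ 1
  ext : ∀ i j, base i = base j → coef i = coef j → i = j
  exists_relabel : ∀ (σ : Equiv.Perm (Fin n)) (ζ : Fin n → ℂ),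
    (∀ p, ζ p ^ ((n - 1) * (n - 2)) = 1) →
      ∃ τ : Equiv.Perm (Fin m), ∀ j, base (τ j) = σ (base j) ∧ coef (τ j) = ζ (base j) * coef j

theorem nonempty_newLabels {n m : ℕ} (hn : 3 ≤ n) (hm : n * (n - 1) * (n - 2) ∣ m) :
    Nonempty (NewLabels n m) := by
  obtain ⟨k, rfl⟩ := hm
  have : NeZero ((n - 1) * (n - 2)) := ⟨exponent_ne_zero hn⟩
  set N := (n - 1) * (n - 2) with hN
  obtain ⟨e⟩ : Nonempty (Fin (n * (n - 1) * (n - 2) * k) ≃ Fin n × (rootsOfUnity N ℂ × Fin k)) :=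
    Finite.card_eq.1 (by
      rw [Nat.card_prod, Nat.card_prod, Complex.card_rootsOfUnity, Nat.card_fin,
        Nat.card_fin, Nat.card_fin, hN]
      ring)
  have hnorm : ∀ ξ : rootsOfUnity N ℂ, ‖((ξ : ℂˣ) : ℂ)‖ = 1 := fun ξ =>
    Complex.norm_eq_one_of_pow_eq_one ((mem_rootsOfUnity' _ _).1 ξ.2) (NeZero.ne N)
  have hpos : ∀ j : Fin k, (0 : ℝ) < (j : ℝ) + 1 := fun j => by positivity
  have hcast : ∀ j : Fin k, ((j : ℂ) + 1) = (((j : ℝ) + 1 : ℝ) : ℂ) := fun j => by push_cast; rfl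
  -- The radii `1 / (j + 1)` are distinct, so the norm recovers `j` and then the root of unity.
  let c : rootsOfUnity N ℂ × Fin k → ℂ := fun a => ((a.1 : ℂˣ) : ℂ) / ((a.2 : ℂ) + 1)
  have hcnorm : ∀ a, ‖c a‖ = ((a.2 : ℝ) + 1)⁻¹ := fun a => by
    simp only [c]
    rw [norm_div, hnorm, hcast, Complex.norm_real, Real.norm_of_nonneg (hpos _).le, one_div]
  have hcinj : Function.Injective c := fun a b hab => by
    have h1 := hcnorm a
    rw [hab, hcnorm b, inv_inj, add_left_inj, Nat.cast_inj] at h1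
    have h2 : a.2 = b.2 := Fin.ext h1.symm
    have h3 : ((b.2 : ℂ) + 1) ≠ 0 := by
      rw [hcast]
      exact Complex.ofReal_ne_zero.2 (hpos _).ne'
    refine Prod.ext (Subtype.ext (Units.ext ?_)) h2
    simp only [c, h2] at hab
    exact (div_left_inj' h3).1 hab
  have hext : ∀ i j, (e i).1 = (e j).1 → c (e i).2 = c (e j).2 → i = j := fun i j h1 h2 =>
    e.injective (Prod.ext h1 (hcinj h2))
  have hne : ∀ j, c (e j).2 ≠ 0 := fun j => by
    rw [← norm_ne_zero_iff, hcnorm]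
    exact (inv_pos.2 (hpos _)).ne'
  refine ⟨⟨fun j => (e j).1, fun j => c (e j).2, hne, fun j => ?_, hext, fun σ ζ hζ => ?_⟩⟩
  · rw [hcnorm]
    exact inv_le_one_of_one_le₀ (by simp)
  · let t : Fin (n * (n - 1) * (n - 2) * k) → Fin (n * (n - 1) * (n - 2) * k) := fun j =>
      e.symm (σ (e j).1, (rootsOfUnity.mkOfPowEq (ζ (e j).1) (hζ _) * (e j).2.1, (e j).2.2))
    have ht : ∀ j, (e (t j)).1 = σ (e j).1 ∧ c (e (t j)).2 = ζ (e j).1 * c (e j).2 := fun j => by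
      simp only [t, c, Equiv.apply_symm_apply]
      refine ⟨trivial, ?_⟩
      rw [Subgroup.coe_mul, Units.val_mul, rootsOfUnity.val_mkOfPowEq_coe, mul_div_assoc]
    have hti : Function.Injective t := fun i j hij => by
      have h1 := (ht i).1
      rw [hij, (ht j).1] at h1
      have h1 := σ.injective h1
      have h2 := (ht i).2
      rw [hij, (ht j).2, h1] at h2
      have hz : ζ (e i).1 ≠ 0 := by
        intro h0
        have := hζ (e i).1
        rw [h0, zero_pow (NeZero.ne N)] at this
        exact zero_ne_one this
      exact hext i j h1.symm (mul_left_cancel₀ hz h2.symm)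
    exact ⟨Equiv.ofBijective t (Finite.injective_iff_bijective.1 hti), ht⟩

/-! ### Adding the new points and descending to the quotient -/

/-- The base points of all labels, old and new. -/
def NewLabels.allBase {n m : ℕ} (L : NewLabels n m) : Fin n ⊕ Fin m → Fin n :=
  Sum.elim id L.base

/-- The coefficients of all labels, which vanish at the old ones. -/
def NewLabels.allCoef {n m : ℕ} (L : NewLabels n m) : Fin n ⊕ Fin m → ℂ :=
  Sum.elim (fun _ => 0) L.coef

theorem NewLabels.symp_displaced_ne_zero {n m : ℕ} (L : NewLabels n m) (hn : 3 ≤ n)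
    {z : (Fin n → ℂ × ℂ) × (Fin n → ℂ)} (hz : IsFramed z) {i j : Fin n ⊕ Fin m} (hij : i ≠ j) :
    symp (displaced z (L.allBase i) (L.allCoef i)) (displaced z (L.allBase j) (L.allCoef j))
      ≠ 0 := by
  have hle : ∀ i, ‖L.allCoef i‖ ≤ 1 := by
    rintro (i | i)
    · simp [allCoef]
    · exact L.norm_coef_le i
  refine hz.symp_displaced_ne_zero hn (hle i) (hle j) fun hb hc => hij ?_
  rcases i with i | i <;> rcases j with j | j
  · exact congrArg Sum.inl hb
  · exact absurd hc.symm (L.coef_ne_zero j)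
  · exact absurd hc (L.coef_ne_zero i)
  · exact congrArg Sum.inr (L.ext i j hb hc)

theorem NewLabels.displaced_ne_zero {n m : ℕ} (L : NewLabels n m) (hn : 3 ≤ n)
    {z : (Fin n → ℂ × ℂ) × (Fin n → ℂ)} (hz : IsFramed z) (i : Fin n ⊕ Fin m) :
    displaced z (L.allBase i) (L.allCoef i) ≠ 0 := by
  obtain ⟨q, hq⟩ := exists_ne_fin hn ⟨0, by omega⟩
  by_cases h : i = Sum.inl q
  · exact ne_zero_of_symp_left (L.symp_displaced_ne_zero hn hz (j := Sum.inl ⟨0, by omega⟩)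
      (by rw [h]; exact fun h' => hq (Sum.inl_injective h').symm))
  · exact ne_zero_of_symp_left (L.symp_displaced_ne_zero hn hz h)

/-- The configuration of old and new points represented by a framed family. -/
noncomputable def NewLabels.addPoints {n m : ℕ} (L : NewLabels n m) (hn : 3 ≤ n)
    (z : {z : (Fin n → ℂ × ℂ) × (Fin n → ℂ) // IsFramed z}) :
    PConf (Fin n ⊕ Fin m) TwoSphere :=
  ⟨fun i => ⟨hopfVec (displaced z.1 (L.allBase i) (L.allCoef i)),
    hopfVec_mem_sphere (L.displaced_ne_zero hn z.2 i)⟩, fun i j h => by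
    by_contra hij
    exact L.symp_displaced_ne_zero hn z.2 hij (symp_eq_zero_of_hopfVec_eq
      (L.displaced_ne_zero hn z.2 i) (L.displaced_ne_zero hn z.2 j) (congrArg Subtype.val h))⟩

theorem NewLabels.continuous_addPoints {n m : ℕ} (L : NewLabels n m) (hn : 3 ≤ n) :
    Continuous (L.addPoints hn) :=
  Continuous.subtype_mk (continuous_pi fun i => Continuous.subtype_mk
    (Continuous.hopfVec (continuous_displaced hn _ _) fun z => L.displaced_ne_zero hn z.2 i) _) _

theorem NewLabels.addPoints_inl {n m : ℕ} (L : NewLabels n m) (hn : 3 ≤ n)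
    (z : {z : (Fin n → ℂ × ℂ) × (Fin n → ℂ) // IsFramed z}) (p : Fin n) :
    (L.addPoints hn z).1 (Sum.inl p) = (framedConf hn z).1 p := by
  refine Subtype.ext ?_
  change hopfVec (displaced z.1 p 0) = hopfVec (z.1.1 p)
  rw [displaced_zero]

/-- A reframing rescales each displaced spinor, which the Hopf map ignores, and multiplies
coefficients by roots of unity, which the labels absorb into `τ`. -/
theorem NewLabels.addPoints_equiv {n m : ℕ} (L : NewLabels n m) (hn : 3 ≤ n)
    (z z' : {z : (Fin n → ℂ × ℂ) × (Fin n → ℂ) // IsFramed z})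
    (h : (PConf.orbitSetoid TwoSphere (⊤ : Subgroup (Equiv.Perm (Fin n)))).r
      (framedConf hn z) (framedConf hn z')) :
    (PConf.orbitSetoid TwoSphere (twoColourPerms n m)).r
      (L.addPoints hn z) (L.addPoints hn z') := by
  obtain ⟨σ, -, hσ⟩ := h
  obtain ⟨l, ζ, hl, hζ⟩ := z.2.exists_isReframing hn z'.2 (σ := σ)
    fun p => congrArg Subtype.val (hσ p)
  obtain ⟨τ, hτ⟩ := L.exists_relabel σ ζ hζ
  refine ⟨_, ⟨(σ, τ), rfl⟩, ?_⟩
  rintro (p | j)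
  · simp only [Equiv.Perm.sumCongrHom_apply, Equiv.Perm.sumCongr_apply, Sum.map_inl]
    rw [L.addPoints_inl, L.addPoints_inl, hσ]
  · refine Subtype.ext ?_
    change hopfVec (displaced z'.1 (L.base j) (L.coef j)) =
      hopfVec (displaced z.1 (L.base (τ j)) (L.coef (τ j)))
    rw [hl.displaced, hopfVec_smul (hl _).1, (hτ j).1, (hτ j).2]

theorem theoremA (n m : ℕ) (hn : 3 ≤ n) (hm : n * (n - 1) * (n - 2) ∣ m) :
    ∃ S : Conf n TwoSphere → ConfTwo n m TwoSphere,
      Continuous S ∧ ∀ c : Conf n TwoSphere, ConfTwo.forget n m TwoSphere (S c) = c := by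
  obtain ⟨L⟩ := nonempty_newLabels hn hm
  -- This choice need not be continuous; the resulting class does not depend on it.
  choose lift hlift using framedConf_surjective hn
  let S : Conf n TwoSphere → ConfTwo n m TwoSphere :=
    Quotient.lift (fun x => Quotient.mk _ (L.addPoints hn (lift x))) fun x y hxy =>
      Quotient.sound (L.addPoints_equiv hn _ _ (by
        rw [hlift, hlift]
        exact hxy))
  refine ⟨S, ?_, ?_⟩
  · refine isQuotientMap_quotient_mk'.continuous_iff.2
      (continuous_of_local_sections (framedConf_surjective hn)
        (exists_local_section_framedConf hn) ?_)
    refine (continuous_quotient_mk'.comp (L.continuous_addPoints hn)).congr fun z => ?_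
    refine Quotient.sound (L.addPoints_equiv hn _ _ ?_)
    rw [hlift]
  · intro c
    induction c using Quotient.inductionOn with
    | h x =>
      refine congrArg (Quotient.mk _) (Subtype.ext (funext fun p => ?_))
      refine (L.addPoints_inl hn (lift x) p).trans ?_
      rw [hlift]
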